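/- Let $f\colon X\to\{0,1\}$ with $X\subseteq\{0,1\}^m$ be a possibly partial Boolean function. A randomized algorithm is a probability distribution over deterministic decision trees, each of which queries single bits of the input. For $\gamma\in(0,1]$, the worst-case randomized query complexity $\mathrm{R}_\gamma(P)$ of a function or relation $P$ is the minimum, over all randomized algorithms that output a correct answer with probability at least $\gamma$ on every input in the domain of $P$, of the maximum number of queries made by a decision tree in the support of the algorithm on an input in the domain of $P$. Write $\mathrm{R}(f)=\mathrm{R}_{2/3}(f)$. For $0\le k\le n$ and $y\in\{0,1\}^n$ let $$\mathrm{Label}^n_k(y)=\{z\in\{0,1,*\}^n : |\{i\in[n]: z_i\ne *\}|=k \text{ and, for all } i\in[n],\ z_i\neq *\Rightarrow z_i=y_i\},$$ and let $\mathrm{Label}^n_k\circ f$ be the problem of producing, on input $(x^{(1)},\dots,x^{(n)})\in X^n$, an element of $\mathrm{Label}^n_k(f(x^{(1)}),\dots,f(x^{(n)}))$. For $n\ge 1$ let $\mathrm{Choice}^n\circ f$ be the problem of producing, on the same inputs, a pair $(i,b)\in[n]\times\{0,1\}$ with $b=f(x^{(i)})$. **Labelled Threshold Direct Product Theorem.**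 There are universal constants $c\in(\tfrac12,1)$ and $C>0$ such that for every $m\in\mathbb{N}$, every (possibly partial) function $f\colon X\to\{0,1\}$ with $X\subseteq\{0,1\}^m$, every $n\in\mathbb{N}$, every $k\in\{0,\dots,n\}$ and every $\gamma\in[c,1)$, $$\mathrm{R}_{\gamma^k}\big(\mathrm{Label}^n_k\circ f\big)\ \ge\ C\,k\,\mathrm{R}(f).$$ In particular, for $k=1$, the choice problem satisfies $\mathrm{R}_{\gamma}\big(\mathrm{Choice}^n\circ f\big)\ge C\,\mathrm{R}(f)$ for every $n\ge1$ and $\gamma\in[c,1)$. -/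

import Mathlib

open scoped NNReal ENNReal

/-- A deterministic decision tree that queries bits of an input `x : ι → Bool` and outputs an
element of `O`.  At a node `query i t₀ t₁` it reads the bit `x i` and continues with `t₀` if the
bit is `0` (`false`) and with `t₁` if it is `1` (`true`). -/
inductive DecisionTree (ι O : Type) : Type
  | leaf (o : O) : DecisionTree ι O
  | query (i : ι) (t₀ t₁ : DecisionTree ι O) : DecisionTree ι O

namespace DecisionTree

variable {ι O : Type}

/-- The label of the leaf reached by the input `x`. -/
def output : DecisionTree ι O → (ι → Bool) → O
  | leaf o, _ => o
  | query i t₀ t₁, x => if x i then t₁.output x else t₀.output x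

/-- The depth of the leaf reached by the input `x`, that is, the number of queries made on `x`. -/
def cost : DecisionTree ι O → (ι → Bool) → ℕ
  | leaf _, _ => 0
  | query i t₀ t₁, x => (if x i then t₁.cost x else t₀.cost x) + 1

end DecisionTree

/-- A (possibly partial) computational problem on inputs in `{0,1}^ι`: the set of legal inputs
and, for every legal input, the set of correct outputs. -/
structure QueryProblem (ι O : Type) where
  dom : Set (ι → Bool)
  sol : dom → Set O

/-- The problem of computing a partial Boolean function `f : X → {0,1}`, `X ⊆ {0,1}^ι`. -/
def QueryProblem.ofFun {ι : Type} {X : Set (ι → Bool)} (f : X → Bool) : QueryProblem ι Bool where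
  dom := X
  sol x := {f x}

/-- The problem `S ∘ f^n`: on a legal input `(x⁽¹⁾, …, x⁽ⁿ⁾) ∈ X^n`, whose `j`-th bit of the `i`-th
block is indexed by `(i, j)`, the correct outputs are the elements of
`S (f(x⁽¹⁾), …, f(x⁽ⁿ⁾))`. -/
def QueryProblem.comp {ι O : Type} {n : ℕ} (S : (Fin n → Bool) → Set O)
    {X : Set (ι → Bool)} (f : X → Bool) : QueryProblem (Fin n × ι) O where
  dom := {x | ∀ i, (fun j => x (i, j)) ∈ X}
  sol x := S fun i => f ⟨fun j => x.1 (i, j), x.2 i⟩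

/-- A randomized algorithm: a probability distribution over deterministic decision trees. -/
abbrev RandomizedAlgorithm (ι O : Type) : Type := PMF (DecisionTree ι O)

namespace RandomizedAlgorithm

variable {ι O : Type}

/-- The probability that `R` outputs a correct answer on the legal input `x`. -/
noncomputable def successProb (R : RandomizedAlgorithm ι O) (P : QueryProblem ι O) (x : P.dom) :
    ℝ≥0∞ :=
  PMF.toOuterMeasure R {D | D.output x.1 ∈ P.sol x}

/-- `R` succeeds with probability at least `γ` on every legal input of `P`. -/
def Computes (R : RandomizedAlgorithm ι O) (P : QueryProblem ι O) (γ : ℝ) : Prop :=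
  ∀ x : P.dom, ENNReal.ofReal γ ≤ R.successProb P x

/-- The worst-case cost of `R`: the maximum number of queries over all legal inputs and all
decision trees in the support of `R`. -/
noncomputable def worstCost (R : RandomizedAlgorithm ι O) (P : QueryProblem ι O) : ℕ∞ :=
  ⨆ x : P.dom, ⨆ D ∈ PMF.support R, (D.cost x.1 : ℕ∞)

end RandomizedAlgorithm

/-- The worst-case randomized query complexity `R_γ(P)`: the least worst-case cost of a randomized
algorithm that succeeds with probability at least `γ` on every legal input
(`⊤` if there is no such algorithm). -/
noncomputable def randQueryComplexity {ι O : Type} (γ : ℝ) (P : QueryProblem ι O) : ℕ∞ :=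
  ⨅ R : {R : RandomizedAlgorithm ι O // R.Computes P γ}, R.1.worstCost P

/-- The `k`-of-`n` labelled threshold relation.  The symbol `*` is `none`. -/
def labelThreshold (n k : ℕ) (y : Fin n → Bool) : Set (Fin n → Option Bool) :=
  {z | (Finset.univ.filter fun i => z i ≠ none).card = k ∧ ∀ i, z i ≠ none → z i = some (y i)}

/-- The choice (one-of-`n`) relation: a pair `(i, b)` is correct if `b` is the `i`-th value. -/
def choiceRelation (n : ℕ) (y : Fin n → Bool) : Set (Fin n × Bool) :=
  {p | p.2 = y p.1}

/-! Suppose R(f) ≥ ρ > 0 and consider a game in which a correct answer gains 1, a wrong one loses 2,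
abstaining is free and each query costs 3/ρ. A randomized strategy with negative expected loss on
every input could be restarted until it answers, which would compute f with error 1/3 in fewer than
ρ queries (`exists_restart`). By minimax, some input distribution μ therefore leaves no tree with
negative expected loss (`exists_hard_distribution`).

Feed n independent samples of μ to an algorithm for the composed problem. The inputs reaching a node
form a product of weights, one per block. Give each block the potential "mass minus half the least
loss", which is at most 1 for μ. A query multiplies the product of potentials, summed over both
children, by at most 1 + 3/(2ρ) (`potential_restrict_add_le`). At a leaf, the mass on which a given
label is right is at most 2/3 of the block's potential (`sum_filter_le_potential`). Hence d queries
label k blocks correctly with probability at most (2/3)^k (1 + 3/(2ρ))^d (`successMass_le`), which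
is below (3/4)^k when d < kρ/20. -/

namespace DecisionTree

/-! ### Restarting an abstaining algorithm -/

variable {ι : Type}

/-- Run a tree whose outputs may be `none` ("undecided") with a budget of `b` queries.  If the tree
is undecided, continue with the tree that `K` provides for the remaining budget; if the budget is
exceeded, give up with an arbitrary answer. -/
def graft (K : ℕ → DecisionTree ι Bool) : DecisionTree ι (Option Bool) → ℕ → DecisionTree ι Bool
  | leaf (some o), _ => leaf o
  | leaf none, b => K b
  | query _ _ _, 0 => leaf false
  | query i t₀ t₁, b + 1 => query i (graft K t₀ b) (graft K t₁ b)

theorem cost_graft_le (K : ℕ → DecisionTree ι Bool) (hK : ∀ b x, (K b).cost x ≤ b)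
    (D : DecisionTree ι (Option Bool)) (b : ℕ) (x : ι → Bool) : (graft K D b).cost x ≤ b := by
  induction D generalizing b with
  | leaf o => cases o <;> simp [graft, cost, hK]
  | query i t₀ t₁ h₀ h₁ =>
    cases b with
    | zero => simp [graft, cost]
    | succ b =>
      simp only [graft, cost]
      split_ifs
      · exact Nat.succ_le_succ (h₁ b)
      · exact Nat.succ_le_succ (h₀ b)

theorem output_graft_some (K : ℕ → DecisionTree ι Bool) (D : DecisionTree ι (Option Bool)) (b : ℕ)
    (x : ι → Bool) (o : Bool) (hb : D.cost x ≤ b) (ho : D.output x = some o) :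
    (graft K D b).output x = o := by
  induction D generalizing b with
  | leaf o => simp only [output] at ho; simp [graft, output, ho]
  | query i t₀ t₁ h₀ h₁ =>
    cases b with
    | zero => simp [cost] at hb
    | succ b =>
      simp only [graft, cost, output] at hb ho ⊢
      split_ifs with h
      · simp only [h, if_true] at hb ho
        exact h₁ b (by omega) ho
      · simp only [h, if_false, Bool.false_eq_true] at hb ho
        exact h₀ b (by omega) ho

theorem output_graft_none (K : ℕ → DecisionTree ι Bool) (D : DecisionTree ι (Option Bool)) (b : ℕ)
    (x : ι → Bool) (hb : D.cost x ≤ b) (ho : D.output x = none) :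
    (graft K D b).output x = (K (b - D.cost x)).output x := by
  induction D generalizing b with
  | leaf o => simp only [output] at ho; simp [graft, cost, ho]
  | query i t₀ t₁ h₀ h₁ =>
    cases b with
    | zero => simp [cost] at hb
    | succ b =>
      simp only [graft, cost, output] at hb ho ⊢
      split_ifs with h
      · simp only [h, if_true] at hb ho
        rw [h₁ b (by omega) ho, Nat.add_sub_add_right]
      · simp only [h, if_false, Bool.false_eq_true] at hb ho
        rw [h₀ b (by omega) ho, Nat.add_sub_add_right]

/-- The loss of an answer in a game where one may abstain: a correct answer gains `1`, a wrong one
loses `2`, abstaining is free. -/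
def answerLoss : Option Bool → Bool → ℝ
  | none, _ => 0
  | some o, y => if o = y then -1 else 2

theorem neg_one_le_answerLoss (o : Option Bool) (y : Bool) : -1 ≤ answerLoss o y := by
  rcases o with _ | o
  · simp [answerLoss]
  · simp only [answerLoss]; split_ifs <;> norm_num

/-- The loss of the answer of `D` on `x`, plus a price `a` for each query, when the correct answer
is `y`. -/
noncomputable def loss (a : ℝ) (D : DecisionTree ι (Option Bool)) (x : ι → Bool) (y : Bool) : ℝ :=
  answerLoss (D.output x) y + a * D.cost x

theorem neg_one_le_loss {a : ℝ} (ha : 0 ≤ a) (D : DecisionTree ι (Option Bool)) (x : ι → Bool)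
    (y : Bool) : -1 ≤ loss a D x y :=
  (neg_one_le_answerLoss _ y).trans (le_add_of_nonneg_right (by positivity))

/-- The indicator that `D` errs on `x`. -/
def err (D : DecisionTree ι Bool) (x : ι → Bool) (y : Bool) : ℝ :=
  if D.output x = y then 0 else 1

theorem err_nonneg (D : DecisionTree ι Bool) (x : ι → Bool) (y : Bool) : 0 ≤ D.err x y := by
  unfold err; split_ifs <;> norm_num

theorem err_le_one (D : DecisionTree ι Bool) (x : ι → Bool) (y : Bool) : D.err x y ≤ 1 := by
  unfold err; split_ifs <;> norm_num

/-- Write V(b) for the assumed error bound with budget b. Abstaining after c queries leaves V(b - c)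
= V(b) + c/ρ. A right answer needs only V(b) ≥ 1/3 and a wrong one only V(b) ≥ 1/3, which explains
the gain 1 and the penalty 2 after scaling by 1/3. Overrunning the budget costs so much that the
bound exceeds 1. -/
theorem sum_err_graft_le {L : Type} [Fintype L] {q : L → ℝ} (hq : ∀ l, 0 ≤ q l)
    (hq1 : ∑ l, q l = 1) (K : L → ℕ → DecisionTree ι Bool) (x : ι → Bool) (y : Bool) {ρ : ℕ}
    (hρ : 0 < ρ) {δ : ℝ} (hδ : 0 ≤ δ)
    (hK : ∀ b, b + 1 ≤ ρ →
      ∑ l, q l * (K l b).err x y ≤ 1 / 3 + ((ρ : ℝ) - 1 - b) / ρ + δ)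
    (D : DecisionTree ι (Option Bool)) {b : ℕ} (hb : b + 1 ≤ ρ) :
    ∑ l, q l * (graft (K l) D b).err x y ≤
      1 / 3 + ((ρ : ℝ) - 1 - b) / ρ + δ + 1 / 3 * loss (3 / ρ) D x y := by
  have hρ' : (0 : ℝ) < ρ := by exact_mod_cast hρ
  have hb' : (b : ℝ) + 1 ≤ ρ := by exact_mod_cast hb
  have hrew : 1 / 3 * loss (3 / ρ) D x y = 1 / 3 * answerLoss (D.output x) y + D.cost x / ρ := by
    unfold loss; field_simp
  have hc : (0 : ℝ) ≤ D.cost x / ρ := by positivity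
  have h0 : 0 ≤ ((ρ : ℝ) - 1 - b) / ρ := div_nonneg (by linarith) hρ'.le
  have hone : ∑ l, q l * (graft (K l) D b).err x y ≤ 1 := by
    rw [← hq1]
    exact Finset.sum_le_sum fun l _ => mul_le_of_le_one_right (hq l) (err_le_one _ _ _)
  rw [hrew]
  rcases le_or_gt (D.cost x) b with hcb | hcb
  · rcases ho : D.output x with _ | o
    · have h1 : b - D.cost x + 1 ≤ ρ := by omega
      have h2 : ∑ l, q l * (graft (K l) D b).err x y
          = ∑ l, q l * (K l (b - D.cost x)).err x y := by
        simp only [err, output_graft_none _ D b x hcb ho]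
      have h3 := hK _ h1
      rw [Nat.cast_sub hcb] at h3
      have h4 : ((ρ : ℝ) - 1 - (b - D.cost x)) / ρ = ((ρ : ℝ) - 1 - b) / ρ + D.cost x / ρ := by
        ring
      rw [h2]
      simp only [answerLoss]
      linarith
    · by_cases hoy : o = y
      · have h2 : ∑ l, q l * (graft (K l) D b).err x y = 0 := by
          simp [err, output_graft_some _ D b x o hcb ho, hoy]
        simp only [answerLoss, hoy, if_true]
        linarith
      · simp only [answerLoss, hoy, if_false]
        linarith
  · have h1 : 1 ≤ ((ρ : ℝ) - 1 - b) / ρ + D.cost x / ρ := by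
      rw [← add_div, le_div_iff₀ hρ']
      have : (b : ℝ) + 1 ≤ D.cost x := by exact_mod_cast hcb
      linarith
    have := neg_one_le_answerLoss (D.output x) y
    linarith

/-- Restarting an undecided randomized tree of negative expected loss, until it answers. -/
theorem exists_restart {J : Type} [Fintype J] {p : J → ℝ} (hp : ∀ j, 0 ≤ p j)
    (hp1 : ∑ j, p j = 1) (D : J → DecisionTree ι (Option Bool)) {ρ : ℕ} (hρ : 0 < ρ) {η : ℝ}
    (hη : 0 < η) (N : ℕ) :
    ∃ (L : Type) (_ : Fintype L) (q : L → ℝ) (K : L → ℕ → DecisionTree ι Bool),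
      (∀ l, 0 ≤ q l) ∧ ∑ l, q l = 1 ∧ (∀ l b x, (K l b).cost x ≤ b) ∧
      ∀ x y, ∑ j, p j * loss (3 / ρ) (D j) x y ≤ -η → ∀ b, b + 1 ≤ ρ →
        ∑ l, q l * (K l b).err x y ≤
          1 / 3 + ((ρ : ℝ) - 1 - b) / ρ + max 0 (2 / 3 - N * (η / 3)) := by
  have hρ' : (0 : ℝ) < ρ := by exact_mod_cast hρ
  induction N with
  | zero =>
    -- With no rounds, the slack 2/3 makes the bound at least 1, so any answer will do.
    refine ⟨Unit, inferInstance, fun _ => 1, fun _ _ => leaf false, by simp, by simp,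
      by simp [cost], fun x y _ b hb => ?_⟩
    have hb' : (b : ℝ) + 1 ≤ ρ := by exact_mod_cast hb
    have h0 : 0 ≤ ((ρ : ℝ) - 1 - b) / ρ := div_nonneg (by linarith) hρ'.le
    have h1 := err_le_one (leaf false) x y
    have h2 := le_max_right (0 : ℝ) (2 / 3 - (0 : ℕ) * (η / 3))
    simp only [Finset.univ_unique, Finset.sum_const, Finset.card_singleton, one_smul, one_mul]
    push_cast at h2 ⊢
    linarith
  | succ N ih =>
    obtain ⟨L, _, q, K, hq, hq1, hcost, herr⟩ := ih
    -- An independent run is put in front of the earlier ones; its expected loss lowers the slack by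
    -- η/3.
    refine ⟨J × L, inferInstance, fun s => p s.1 * q s.2, fun s b => graft (K s.2) (D s.1) b,
      fun s => mul_nonneg (hp _) (hq _), ?_, fun s b x => cost_graft_le _ (hcost _) _ _ _,
      fun x y hxy b hb => ?_⟩
    · rw [Fintype.sum_prod_type]
      simp only [← Finset.mul_sum, hq1, mul_one, hp1]
    · rw [Fintype.sum_prod_type]
      simp only [mul_assoc, ← Finset.mul_sum]
      set δ := max 0 (2 / 3 - N * (η / 3)) with hδ
      calc ∑ j, p j * ∑ l, q l * (graft (K l) (D j) b).err x y
          ≤ ∑ j, p j * (1 / 3 + ((ρ : ℝ) - 1 - b) / ρ + δ + 1 / 3 * loss (3 / ρ) (D j) x y) :=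
            Finset.sum_le_sum fun j _ => mul_le_mul_of_nonneg_left
              (sum_err_graft_le hq hq1 K x y hρ (le_max_left _ _) (herr x y hxy) (D j) hb) (hp j)
        _ = 1 / 3 + ((ρ : ℝ) - 1 - b) / ρ + δ + 1 / 3 * ∑ j, p j * loss (3 / ρ) (D j) x y := by
            simp only [mul_add, Finset.sum_add_distrib, ← Finset.sum_mul, hp1, one_mul,
              Finset.mul_sum]
            congr 1
            exact Finset.sum_congr rfl fun j _ => by ring
        _ ≤ _ := by
            have : δ - η / 3 ≤ max 0 (2 / 3 - ((N + 1 : ℕ) : ℝ) * (η / 3)) := by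
              push_cast
              rcases max_cases (0 : ℝ) (2 / 3 - N * (η / 3)) with ⟨h, _⟩ | ⟨h, _⟩
              · exact le_max_of_le_left (by rw [hδ, h]; linarith)
              · exact le_max_of_le_right (by rw [hδ, h]; linarith)
            linarith

end DecisionTree

/-! ### A hard input distribution by minimax -/

/-- A finitely supported randomized algorithm bounds the randomized query complexity. -/
theorem randQueryComplexity_ofFun_le {ι : Type} {X : Set (ι → Bool)} (f : X → Bool) {L : Type}
    [Fintype L] {q : L → ℝ} (hq : ∀ l, 0 ≤ q l) (hq1 : ∑ l, q l = 1)
    (K : L → DecisionTree ι Bool) (b : ℕ) (hcost : ∀ l x, (K l).cost x ≤ b)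
    (herr : ∀ x : X, ∑ l, q l * (K l).err x.1 (f x) ≤ 1 / 3) :
    randQueryComplexity (2 / 3) (QueryProblem.ofFun f) ≤ b := by
  have hsum : ∑ l, ENNReal.ofReal (q l) = 1 := by
    rw [← ENNReal.ofReal_sum_of_nonneg fun l _ => hq l, hq1, ENNReal.ofReal_one]
  let R : RandomizedAlgorithm ι Bool := (PMF.ofFintype _ hsum).map K
  have hR : R.Computes (QueryProblem.ofFun f) (2 / 3) := by
    intro x
    unfold RandomizedAlgorithm.successProb
    rw [PMF.toOuterMeasure_map_apply, PMF.toOuterMeasure_ofFintype_apply, tsum_fintype]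
    have hx := herr x
    have key : ∀ l, Set.indicator (K ⁻¹' {D | D.output x.1 ∈ (QueryProblem.ofFun f).sol x})
        (fun l => ENNReal.ofReal (q l)) l = ENNReal.ofReal (q l - q l * (K l).err x.1 (f x)) := by
      intro l
      by_cases h : (K l).output x.1 = f x
      · rw [Set.indicator_of_mem (by exact h)]
        simp [DecisionTree.err, h]
      · rw [Set.indicator_of_notMem (by exact h)]
        simp [DecisionTree.err, h]
    rw [Finset.sum_congr rfl fun l _ => key l, ← ENNReal.ofReal_sum_of_nonneg]
    · apply ENNReal.ofReal_le_ofReal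
      rw [Finset.sum_sub_distrib, hq1]
      linarith
    · intro l _
      have := mul_le_of_le_one_right (hq l) ((K l).err_le_one x.1 (f x))
      linarith
  refine (iInf_le _ ⟨R, hR⟩).trans ?_
  refine iSup_le fun x => iSup_le fun D => iSup_le fun hD => ?_
  rw [PMF.support_map] at hD
  obtain ⟨l, -, rfl⟩ := hD
  exact_mod_cast hcost l x.1

/-- If a finitely supported randomized tree has negative expected loss on every input, then
restarting it computes `f`. -/
theorem randQueryComplexity_lt_of_loss_neg {ι : Type} {X : Set (ι → Bool)} [Finite X]
    (f : X → Bool) {J : Type} [Fintype J] {p : J → ℝ} (hp : ∀ j, 0 ≤ p j) (hp1 : ∑ j, p j = 1)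
    (D : J → DecisionTree ι (Option Bool)) {ρ : ℕ} (hρ : 0 < ρ)
    (hD : ∀ x : X, ∑ j, p j * (D j).loss (3 / ρ) x.1 (f x) < 0) :
    randQueryComplexity (2 / 3) (QueryProblem.ofFun f) < ρ := by
  obtain ⟨η, hη, hlt⟩ : ∃ η : ℝ, 0 < η ∧
      ∀ x : X, ∑ j, p j * (D j).loss (3 / ρ) x.1 (f x) ≤ -η := by
    -- Finiteness of `X` gives one margin `η` for all inputs.
    have h : ∀ᶠ η in nhdsWithin (0 : ℝ) (Set.Ioi 0),
        ∀ x : X, η < -∑ j, p j * (D j).loss (3 / ρ) x.1 (f x) :=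
      Filter.eventually_all.2 fun x =>
        Filter.Eventually.filter_mono nhdsWithin_le_nhds (eventually_lt_nhds (by
          have := hD x
          linarith))
    obtain ⟨η, h1, h2⟩ := (h.and self_mem_nhdsWithin).exists
    exact ⟨η, h2, fun x => by have := h1 x; linarith⟩
  obtain ⟨N, hN⟩ := exists_nat_gt (2 / 3 / (η / 3))
  rw [div_lt_iff₀ (by positivity)] at hN
  obtain ⟨L, _, q, K, hq, hq1, hcost, herr⟩ := DecisionTree.exists_restart hp hp1 D hρ hη N
  -- Budget `ρ - 1` makes the budget term vanish, leaving error 1/3 once `N` has exhausted the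
  -- slack.
  have hle : randQueryComplexity (2 / 3) (QueryProblem.ofFun f) ≤ ((ρ - 1 : ℕ) : ℕ∞) := by
    refine randQueryComplexity_ofFun_le f hq hq1 (fun l => K l (ρ - 1)) _
      (fun l x => hcost l _ x) fun x => ?_
    refine (herr x.1 (f x) (hlt x) (ρ - 1) (by omega)).trans (le_of_eq ?_)
    rw [max_eq_left (by linarith), Nat.cast_sub (by omega : 1 ≤ ρ)]
    simp
  refine hle.trans_lt ?_
  exact_mod_cast Nat.sub_lt hρ one_pos

/-- A minimax theorem: an input distribution on which no tree has negative expected loss. -/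
theorem exists_hard_distribution {ι : Type} {X : Set (ι → Bool)} [Fintype X] (f : X → Bool)
    {ρ : ℕ} (hρ : 0 < ρ) (hR : (ρ : ℕ∞) ≤ randQueryComplexity (2 / 3) (QueryProblem.ofFun f)) :
    ∃ μ : X → ℝ, (∀ x, 0 ≤ μ x) ∧ ∑ x, μ x = 1 ∧
      ∀ D : DecisionTree ι (Option Bool), 0 ≤ ∑ x : X, μ x * D.loss (3 / ρ) x.1 (f x) := by
  classical
  let g : DecisionTree ι (Option Bool) → X → ℝ := fun D x => D.loss (3 / ρ) x.1 (f x)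
  -- Separate the open negative orthant from the convex hull of the loss vectors; the normalized
  -- functional is the distribution.
  let s : Set (X → ℝ) := Set.univ.pi fun _ => Set.Iio 0
  have hs : Convex ℝ s := convex_pi fun _ _ => convex_Iio 0
  have hso : IsOpen s := isOpen_set_pi Set.finite_univ fun _ _ => isOpen_Iio
  have hdisj : Disjoint s (convexHull ℝ (Set.range g)) := by
    rw [Set.disjoint_left]
    intro v hv hv'
    obtain ⟨J, _, p, z, hp, hp1, hz, rfl⟩ := mem_convexHull_iff_exists_fintype.1 hv'
    choose D hD using hz
    refine absurd (randQueryComplexity_lt_of_loss_neg f hp hp1 D hρ fun x => ?_) (not_lt.2 hR)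
    have := hv x trivial
    simpa [← hD, g] using this
  obtain ⟨F, u, hF, hu⟩ := geometric_hahn_banach_open hs hso (convex_convexHull ℝ _) hdisj
  set c : X → ℝ := fun x => F (Pi.single x 1) with hc
  have hFsum : ∀ v : X → ℝ, F v = ∑ x, v x * c x := by
    intro v
    conv_lhs => rw [pi_eq_sum_univ' v]
    simp [map_sum, hc]
  have hFconst : ∀ t : ℝ, F (fun _ => t) = t * ∑ x, c x := fun t => by
    rw [hFsum, Finset.mul_sum]
  have hmin : ∀ D, u ≤ F (g D) := fun D => hu _ (subset_convexHull ℝ _ ⟨D, rfl⟩)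
  have hc0 : ∀ x, 0 ≤ c x := by
    intro x
    by_contra! hneg
    -- A negative coefficient could be exploited by moving far along `-e_x` inside the orthant; this
    -- `t` already takes `F` to at least `u`.
    set t := (|u| + |∑ x, c x|) / (-c x) with ht
    have ht0 : 0 ≤ t := div_nonneg (by positivity) (by linarith)
    have h1 := hF ((fun _ => -1) - t • Pi.single x 1) (by
      intro y _
      have : 0 ≤ t * (Pi.single x 1 : X → ℝ) y :=
        mul_nonneg ht0 (by rw [Pi.single_apply]; split_ifs <;> norm_num)
      simp only [Pi.sub_apply, Pi.smul_apply, smul_eq_mul, Set.mem_Iio]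
      linarith)
    rw [map_sub, map_smul, hFconst, smul_eq_mul, show F (Pi.single x 1) = c x from rfl] at h1
    have h2 : t * c x = -(|u| + |∑ x, c x|) := by
      have := hneg.ne
      rw [ht]; field_simp
    have := le_abs_self u
    have := le_abs_self (∑ x, c x)
    linarith
  have hS0 : 0 ≤ ∑ x, c x := Finset.sum_nonneg fun x _ => hc0 x
  have hneg : ∀ t : ℝ, 0 < t → -t * ∑ x, c x < u := fun t ht =>
    hFconst (-t) ▸ hF _ fun _ _ => by simpa using ht
  have hu0 : 0 ≤ u := by
    by_contra! hlt
    rcases hS0.eq_or_lt with h | h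
    · have := hneg 1 one_pos
      rw [← h] at this
      linarith
    · have h1 := hneg (-u / ∑ x, c x) (div_pos (by linarith) h)
      rw [neg_mul, div_mul_cancel₀ _ h.ne'] at h1
      linarith
  have hS : 0 < ∑ x, c x := by
    refine hS0.lt_of_ne' fun h => ?_
    have h1 := hneg 1 one_pos
    -- Abstaining has zero loss, so `u ≤ 0`, whereas a zero functional would force `0 < u`.
    have h2 := hmin (.leaf none)
    have h3 : g (.leaf none) = fun _ => 0 := by
      funext x
      simp [g, DecisionTree.loss, DecisionTree.answerLoss, DecisionTree.output, DecisionTree.cost]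
    rw [h3, hFconst] at h2
    rw [h] at h1 h2
    linarith
  refine ⟨fun x => c x / ∑ x, c x, fun x => div_nonneg (hc0 x) hS0, ?_, fun D => ?_⟩
  · rw [← Finset.sum_div, div_self hS.ne']
  · have h := hu0.trans (hmin D)
    rw [hFsum] at h
    have : ∑ x : X, c x / (∑ x, c x) * D.loss (3 / ρ) x.1 (f x) = (∑ x, g D x * c x) / ∑ x, c x := by
      rw [Finset.sum_div]
      exact Finset.sum_congr rfl fun x _ => by simp only [g]; ring
    rw [this]
    exact div_nonneg h hS0

/-! ### The potential of a weighted block -/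

namespace DecisionTree

section Restrict

variable {ι : Type}

/-- The part of the weight `w` on the inputs whose `j`-th bit is `b`. -/
def restrict (w : (ι → Bool) → ℝ) (j : ι) (b : Bool) : (ι → Bool) → ℝ :=
  fun x => if x j = b then w x else 0

theorem restrict_nonneg {w : (ι → Bool) → ℝ} (hw : ∀ x, 0 ≤ w x) (j : ι) (b : Bool) (x : ι → Bool) :
    0 ≤ restrict w j b x := by
  unfold restrict; split_ifs <;> simp [hw]

theorem prod_update_restrict {n : ℕ} (w : Fin n → (ι → Bool) → ℝ) (i : Fin n) (j : ι) (b : Bool)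
    (y : Fin n → ι → Bool) :
    ∏ i', Function.update w i (restrict (w i) j b) i' (y i') =
      if y i j = b then ∏ i', w i' (y i') else 0 := by
  split_ifs with h
  · refine Finset.prod_congr rfl fun i' _ => ?_
    by_cases hi : i' = i
    · subst hi; simp [restrict, h]
    · simp [hi]
  · exact Finset.prod_eq_zero (Finset.mem_univ i) (by simp [restrict, h])

end Restrict

instance {ι O : Type} [Nonempty O] : Nonempty (DecisionTree ι O) :=
  ‹Nonempty O›.map leaf

section Potential

variable {ι : Type} [Fintype ι] [DecidableEq ι]

/-- The least expected loss of a tree that computes `F` on inputs weighted by `w`. -/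
noncomputable def minLoss (a : ℝ) (F : (ι → Bool) → Bool) (w : (ι → Bool) → ℝ) : ℝ :=
  ⨅ D : DecisionTree ι (Option Bool), ∑ x, w x * D.loss a x (F x)

/-- The potential of a weight `w`: its total mass, increased by half of the gain that remains
possible. -/
noncomputable def potential (a : ℝ) (F : (ι → Bool) → Bool) (w : (ι → Bool) → ℝ) : ℝ :=
  ∑ x, w x - minLoss a F w / 2

variable {a : ℝ} {F : (ι → Bool) → Bool} {w : (ι → Bool) → ℝ}

theorem bddBelow_loss (ha : 0 ≤ a) (hw : ∀ x, 0 ≤ w x) :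
    BddBelow (Set.range fun D : DecisionTree ι (Option Bool) => ∑ x, w x * D.loss a x (F x)) := by
  refine ⟨∑ x, w x * (-1), ?_⟩
  rintro _ ⟨D, rfl⟩
  exact Finset.sum_le_sum fun x _ => mul_le_mul_of_nonneg_left (neg_one_le_loss ha D x _) (hw x)

theorem minLoss_le (ha : 0 ≤ a) (hw : ∀ x, 0 ≤ w x) (D : DecisionTree ι (Option Bool)) :
    minLoss a F w ≤ ∑ x, w x * D.loss a x (F x) :=
  ciInf_le (bddBelow_loss ha hw) D

theorem minLoss_nonpos (ha : 0 ≤ a) (hw : ∀ x, 0 ≤ w x) : minLoss a F w ≤ 0 :=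
  (minLoss_le ha hw (leaf none)).trans (by simp [loss, output, cost, answerLoss])

theorem sum_le_potential (ha : 0 ≤ a) (hw : ∀ x, 0 ≤ w x) : ∑ x, w x ≤ potential a F w := by
  have := minLoss_nonpos (F := F) ha hw
  unfold potential
  linarith

theorem potential_nonneg (ha : 0 ≤ a) (hw : ∀ x, 0 ≤ w x) : 0 ≤ potential a F w :=
  (Finset.sum_nonneg fun x _ => hw x).trans (sum_le_potential ha hw)

/-- Answering `b` at once has loss 2·mass - 3·(mass where `b` is right). Halving it cancels the mass
term of the potential and leaves 3/2 of the correct mass. -/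
theorem sum_filter_le_potential (ha : 0 ≤ a) (hw : ∀ x, 0 ≤ w x) (b : Bool) :
    ∑ x, (if F x = b then w x else 0) ≤ 2 / 3 * potential a F w := by
  have h := minLoss_le (F := F) ha hw (leaf (some b))
  have h2 : ∑ x, w x * (leaf (some b)).loss a x (F x)
      = 2 * ∑ x, w x - 3 * ∑ x, (if F x = b then w x else 0) := by
    rw [Finset.mul_sum, Finset.mul_sum, ← Finset.sum_sub_distrib]
    refine Finset.sum_congr rfl fun x _ => ?_
    by_cases hx : F x = b
    · simp [loss, output, cost, answerLoss, hx]; ring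
    · simp [loss, output, cost, answerLoss, hx, Ne.symm hx]; ring
  unfold potential
  linarith

theorem sum_restrict_add (w : (ι → Bool) → ℝ) (j : ι) :
    ∑ x, restrict w j false x + ∑ x, restrict w j true x = ∑ x, w x := by
  rw [← Finset.sum_add_distrib]
  refine Finset.sum_congr rfl fun x _ => ?_
  cases h : x j <;> simp [restrict, h]

/-- Query `j` first, then play nearly optimally on each half; the query is charged to the whole
mass. -/
theorem minLoss_le_restrict (ha : 0 ≤ a) (hw : ∀ x, 0 ≤ w x) (j : ι) :
    minLoss a F w ≤
      minLoss a F (restrict w j false) + minLoss a F (restrict w j true) + a * ∑ x, w x := by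
  have key : ∀ D₀ D₁ : DecisionTree ι (Option Bool), minLoss a F w ≤
      ∑ x, restrict w j false x * D₀.loss a x (F x) +
        ∑ x, restrict w j true x * D₁.loss a x (F x) + a * ∑ x, w x := by
    intro D₀ D₁
    refine (minLoss_le ha hw (query j D₀ D₁)).trans (le_of_eq ?_)
    rw [Finset.mul_sum, ← Finset.sum_add_distrib, ← Finset.sum_add_distrib]
    refine Finset.sum_congr rfl fun x _ => ?_
    cases h : x j <;> simp [restrict, loss, output, cost, h] <;> ring
  have h1 : ∀ D₁ : DecisionTree ι (Option Bool), minLoss a F w - a * ∑ x, w x -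
      ∑ x, restrict w j true x * D₁.loss a x (F x) ≤ minLoss a F (restrict w j false) :=
    fun D₁ => le_ciInf (α := ℝ) fun D₀ => by linarith [key D₀ D₁]
  have h2 : minLoss a F w - a * ∑ x, w x - minLoss a F (restrict w j false) ≤
      minLoss a F (restrict w j true) :=
    le_ciInf (α := ℝ) fun D₁ => by linarith [h1 D₁]
  linarith

theorem potential_restrict_add_le (ha : 0 ≤ a) (hw : ∀ x, 0 ≤ w x) (j : ι) :
    potential a F (restrict w j false) + potential a F (restrict w j true) ≤
      (1 + a / 2) * potential a F w := by
  have h1 := sum_restrict_add w j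
  have h2 := minLoss_le_restrict (F := F) ha hw j
  have h3 := mul_le_mul_of_nonneg_left (sum_le_potential (F := F) ha hw) ha
  unfold potential at h3 ⊢
  linarith

end Potential

/-! ### Success on independent blocks -/

section Product

variable {ι O : Type} [Fintype ι] [DecidableEq ι] {n : ℕ}

/-- The success mass of `D` for the relation `S ∘ F^n`, on inputs of `n` independent blocks weighted
by `w`. -/
noncomputable def successMass (F : (ι → Bool) → Bool) (S : (Fin n → Bool) → Set O)
    (w : Fin n → (ι → Bool) → ℝ) (D : DecisionTree (Fin n × ι) O) : ℝ :=
  ∑ y : Fin n → ι → Bool, (∏ i, w i (y i)) *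
    Set.indicator {y | D.output (fun q => y q.1 q.2) ∈ S fun i => F (y i)} 1 y

theorem successMass_eq_zero {F : (ι → Bool) → Bool} {S : (Fin n → Bool) → Set O}
    {w : Fin n → (ι → Bool) → ℝ} {D : DecisionTree (Fin n × ι) O}
    (h : ∀ y : Fin n → ι → Bool, ∏ i, w i (y i) = 0) : successMass F S w D = 0 := by
  simp [successMass, h]

theorem successMass_query (F : (ι → Bool) → Bool) (S : (Fin n → Bool) → Set O)
    (w : Fin n → (ι → Bool) → ℝ) (i : Fin n) (j : ι) (D₀ D₁ : DecisionTree (Fin n × ι) O) :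
    successMass F S w (query (i, j) D₀ D₁) =
      successMass F S (Function.update w i (restrict (w i) j false)) D₀ +
        successMass F S (Function.update w i (restrict (w i) j true)) D₁ := by
  classical
  unfold successMass
  rw [← Finset.sum_add_distrib]
  refine Finset.sum_congr rfl fun y _ => ?_
  rw [prod_update_restrict, prod_update_restrict]
  cases h : y i j <;> simp [output, Set.indicator_apply, h]

/-- Whenever an output is correct for `S`, it determines `k` of the `n` values. -/
def Labels (S : (Fin n → Bool) → Set O) (k : ℕ) : Prop :=
  ∀ o, (∃ v, o ∈ S v) → ∃ z : Fin n → Option Bool,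
    (Finset.univ.filter fun i => z i ≠ none).card = k ∧
      ∀ v, o ∈ S v → ∀ i, z i ≠ none → z i = some (v i)

variable {a : ℝ} {F : (ι → Bool) → Bool} {S : (Fin n → Bool) → Set O} {k : ℕ}

/-- At a leaf the output is fixed, so success forces `k` separate block events and their masses
multiply. -/
theorem successMass_leaf_le (ha : 0 ≤ a) (hS : Labels S k) {w : Fin n → (ι → Bool) → ℝ}
    (hw : ∀ i x, 0 ≤ w i x) (o : O) :
    successMass F S w (leaf o) ≤ (2 / 3) ^ k * ∏ i, potential a F (w i) := by
  classical
  by_cases ho : ∃ v, o ∈ S v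
  · obtain ⟨z, hz, hv⟩ := hS o ho
    let s : Fin n → (ι → Bool) → ℝ := fun i x =>
      if z i = none ∨ z i = some (F x) then w i x else 0
    have hs0 : ∀ i x, 0 ≤ s i x := fun i x => by simp only [s]; split_ifs <;> simp [hw]
    calc successMass F S w (leaf o) ≤ ∑ y : Fin n → ι → Bool, ∏ i, s i (y i) := by
          refine Finset.sum_le_sum fun y _ => ?_
          rw [Set.indicator_apply]
          split_ifs with h
          · rw [Pi.one_apply, mul_one]
            refine le_of_eq (Finset.prod_congr rfl fun i _ => ?_)
            have : z i = none ∨ z i = some (F (y i)) := or_iff_not_imp_left.2 (hv _ h i)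
            simp [s, this]
          · rw [mul_zero]
            exact Finset.prod_nonneg fun i _ => hs0 i _
      _ = ∏ i, ∑ x, s i x := (Fintype.prod_sum s).symm
      _ ≤ ∏ i, ((if z i ≠ none then (2 / 3 : ℝ) else 1) * potential a F (w i)) := by
          refine Finset.prod_le_prod (fun i _ => Finset.sum_nonneg fun x _ => hs0 i x)
            fun i _ => ?_
          rcases hzi : z i with _ | b
          · simpa [s, hzi] using sum_le_potential ha (hw i)
          · simpa [s, hzi, eq_comm] using sum_filter_le_potential (F := F) ha (hw i) b
      _ = (2 / 3) ^ k * ∏ i, potential a F (w i) := by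
          rw [Finset.prod_mul_distrib, Finset.prod_ite]
          rw [Finset.prod_const_one, mul_one, Finset.prod_const, hz]
  · have : successMass F S w (leaf o) = 0 := by
      refine Finset.sum_eq_zero fun y _ => ?_
      rw [Set.indicator_of_notMem, mul_zero]
      exact fun h => ho ⟨_, h⟩
    rw [this]
    exact mul_nonneg (by positivity) (Finset.prod_nonneg fun i _ => potential_nonneg ha (hw i))

/-- Few queries multiply the potential by little. -/
theorem successMass_le (ha : 0 ≤ a) (hS : Labels S k) (D : DecisionTree (Fin n × ι) O) (d : ℕ)
    {w : Fin n → (ι → Bool) → ℝ} (hw : ∀ i x, 0 ≤ w i x)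
    (hd : ∀ y : Fin n → ι → Bool, ∏ i, w i (y i) ≠ 0 → D.cost (fun q => y q.1 q.2) ≤ d) :
    successMass F S w D ≤ (2 / 3) ^ k * (1 + a / 2) ^ d * ∏ i, potential a F (w i) := by
  have hpot : ∀ {w : Fin n → (ι → Bool) → ℝ}, (∀ i x, 0 ≤ w i x) →
      0 ≤ ∏ i, potential a F (w i) :=
    fun hw => Finset.prod_nonneg fun i _ => potential_nonneg ha (hw i)
  induction D generalizing d w with
  | leaf o =>
    refine (successMass_leaf_le ha hS hw o).trans ?_
    rw [mul_right_comm]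
    exact le_mul_of_one_le_right (mul_nonneg (by positivity) (hpot hw))
      (one_le_pow₀ (by linarith))
  | query p D₀ D₁ h₀ h₁ =>
    obtain ⟨i, j⟩ := p
    cases d with
    | zero =>
      -- With no query left, no input of nonzero weight reaches this node.
      rw [successMass_eq_zero fun y => ?_]
      · exact mul_nonneg (by positivity) (hpot hw)
      · by_contra hy
        simpa [cost] using hd y hy
    | succ d =>
      have hw' : ∀ b i' x, 0 ≤ Function.update w i (restrict (w i) j b) i' x := by
        intro b i' x
        by_cases hi : i' = i
        · subst hi; simpa using restrict_nonneg (hw _) j b x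
        · simpa [hi] using hw i' x
      have e₀ := h₀ d (hw' false) fun y hy => by
        rw [prod_update_restrict] at hy
        obtain ⟨h, hy⟩ := ite_ne_right_iff.1 hy
        have := hd y hy
        simp only [cost, h] at this
        simpa using this
      have e₁ := h₁ d (hw' true) fun y hy => by
        rw [prod_update_restrict] at hy
        obtain ⟨h, hy⟩ := ite_ne_right_iff.1 hy
        have := hd y hy
        simp only [cost, h] at this
        simpa using this
      have hprod : ∀ b, ∏ i', potential a F (Function.update w i (restrict (w i) j b) i') =
          potential a F (restrict (w i) j b) *
            ∏ i' ∈ Finset.univ.erase i, potential a F (w i') := by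
        intro b
        rw [← Finset.mul_prod_erase _ _ (Finset.mem_univ i), Function.update_self]
        congr 1
        exact Finset.prod_congr rfl fun i' hi => by
          rw [Function.update_of_ne (Finset.ne_of_mem_erase hi)]
      rw [hprod] at e₀ e₁
      rw [successMass_query, ← Finset.mul_prod_erase _ _ (Finset.mem_univ i)]
      set P := ∏ i' ∈ Finset.univ.erase i, potential a F (w i')
      have hP : 0 ≤ P := Finset.prod_nonneg fun i _ => potential_nonneg ha (hw i)
      have hstep := potential_restrict_add_le (F := F) ha (hw i) j
      calc _ ≤ (2 / 3) ^ k * (1 + a / 2) ^ d *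
            ((potential a F (restrict (w i) j false) +
              potential a F (restrict (w i) j true)) * P) := by linarith
        _ ≤ (2 / 3) ^ k * (1 + a / 2) ^ d * ((1 + a / 2) * potential a F (w i) * P) := by
          gcongr
        _ = _ := by ring

end Product

end DecisionTree

/-! ### From trees to randomized algorithms -/

/-- An algorithm that labels `k` blocks, averaged over independent blocks distributed by `μ`. -/
theorem RandomizedAlgorithm.computes_comp_le {ι O : Type} [Fintype ι] [DecidableEq ι] {n k : ℕ}
    {S : (Fin n → Bool) → Set O} (hS : DecisionTree.Labels S k) {X : Set (ι → Bool)} {f : X → Bool}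
    {a : ℝ} (ha : 0 ≤ a) {F : (ι → Bool) → Bool} (hF : ∀ x : X, F x = f x) {μ : (ι → Bool) → ℝ}
    (hμ : ∀ x, 0 ≤ μ x) (hμ1 : ∑ x, μ x = 1) (hμX : ∀ x, x ∉ X → μ x = 0)
    (hloss : 0 ≤ DecisionTree.minLoss a F μ) {R : RandomizedAlgorithm (Fin n × ι) O} {γ : ℝ}
    (hR : R.Computes (QueryProblem.comp S f) γ) {d : ℕ}
    (hd : R.worstCost (QueryProblem.comp S f) ≤ d) :
    γ ≤ (2 / 3) ^ k * (1 + a / 2) ^ d := by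
  classical
  set β : ℝ := (2 / 3) ^ k * (1 + a / 2) ^ d with hβ
  have hβ0 : 0 ≤ β := by positivity
  let W : (Fin n → ι → Bool) → ℝ := fun y => ∏ i, μ (y i)
  have hW0 : ∀ y, 0 ≤ W y := fun y => Finset.prod_nonneg fun i _ => hμ _
  have hW1 : ∑ y, W y = 1 := by
    have := Fintype.prod_sum (fun (_ : Fin n) => μ)
    simpa [hμ1, W] using this.symm
  have hdom : ∀ y, W y ≠ 0 →
      (fun q : Fin n × ι => y q.1 q.2) ∈ (QueryProblem.comp S f).dom := fun y hy i => by
    by_contra hi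
    exact hy (Finset.prod_eq_zero (Finset.mem_univ i) (hμX _ hi))
  let A : (Fin n → ι → Bool) → Set (DecisionTree (Fin n × ι) O) := fun y =>
    {D | D.output (fun q => y q.1 q.2) ∈ S fun i => F (y i)}
  have hsucc : ∀ y, ENNReal.ofReal (W y) * ENNReal.ofReal γ ≤
      ENNReal.ofReal (W y) * PMF.toOuterMeasure R (A y) := by
    intro y
    by_cases hy : W y = 0
    · simp [hy]
    · refine mul_le_mul_right ((hR ⟨_, hdom y hy⟩).trans (le_of_eq ?_)) _
      have : (fun i => F (y i)) = fun i => f ⟨y i, hdom y hy i⟩ :=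
        funext fun i => hF ⟨y i, hdom y hy i⟩
      simp only [A, this]
      rfl
  have htree : ∀ D ∈ PMF.support R, DecisionTree.successMass F S (fun _ => μ) D ≤ β := by
    intro D hD
    refine (DecisionTree.successMass_le ha hS D d (fun _ => hμ) fun y hy => ?_).trans ?_
    · have h : (D.cost (fun q => y q.1 q.2) : ℕ∞) ≤ R.worstCost (QueryProblem.comp S f) :=
        (le_iSup₂ (f := fun D' (_ : D' ∈ PMF.support R) =>
          (D'.cost (fun q => y q.1 q.2) : ℕ∞)) D hD).trans
          (le_iSup (fun x : (QueryProblem.comp S f).dom =>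
            ⨆ D ∈ PMF.support R, (D.cost x.1 : ℕ∞)) ⟨_, hdom y hy⟩)
      exact_mod_cast h.trans hd
    -- The hard distribution has mass 1 and nonnegative least loss, so each block starts with
    -- potential at most 1.
    · refine mul_le_of_le_one_right hβ0 (Finset.prod_le_one
        (fun i _ => DecisionTree.potential_nonneg ha hμ) fun i _ => ?_)
      unfold DecisionTree.potential
      linarith
  have hmain : ENNReal.ofReal γ ≤ ENNReal.ofReal β := by
    calc ENNReal.ofReal γ = ∑ y, ENNReal.ofReal (W y) * ENNReal.ofReal γ := by
          rw [← Finset.sum_mul, ← ENNReal.ofReal_sum_of_nonneg fun y _ => hW0 y, hW1]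
          simp
      _ ≤ ∑ y, ENNReal.ofReal (W y) * PMF.toOuterMeasure R (A y) :=
          Finset.sum_le_sum fun y _ => hsucc y
      _ = ∑' y, ∑' D, ENNReal.ofReal (W y) * (A y).indicator R D := by
          simp only [PMF.toOuterMeasure_apply, tsum_fintype, ENNReal.tsum_mul_left]
      _ = ∑' D, R D * ENNReal.ofReal (DecisionTree.successMass F S (fun _ => μ) D) := by
          rw [ENNReal.tsum_comm]
          refine tsum_congr fun D => ?_
          rw [tsum_fintype, DecisionTree.successMass, ENNReal.ofReal_sum_of_nonneg, Finset.mul_sum]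
          · refine Finset.sum_congr rfl fun y _ => ?_
            by_cases h : D ∈ A y
            · have h' : y ∈ {y | D.output (fun q => y q.1 q.2) ∈ S fun i => F (y i)} := h
              rw [Set.indicator_of_mem h, Set.indicator_of_mem h']
              simp [W, mul_comm]
            · have h' : y ∉ {y | D.output (fun q => y q.1 q.2) ∈ S fun i => F (y i)} := h
              rw [Set.indicator_of_notMem h, Set.indicator_of_notMem h']
              simp
          · exact fun y _ => mul_nonneg (hW0 y) (Set.indicator_nonneg (fun _ _ => zero_le_one) _)
      _ ≤ ∑' D, R D * ENNReal.ofReal β := by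
          refine ENNReal.tsum_le_tsum fun D => ?_
          by_cases hD : D ∈ PMF.support R
          · exact mul_le_mul_right (ENNReal.ofReal_le_ofReal (htree D hD)) _
          · rw [PMF.mem_support_iff, not_not] at hD
            simp [hD]
      _ = ENNReal.ofReal β := by rw [ENNReal.tsum_mul_right, PMF.tsum_coe, one_mul]
  exact (ENNReal.ofReal_le_ofReal_iff hβ0).1 hmain

/-- The direct product theorem for every relation that labels `k` blocks. -/
theorem mul_le_randQueryComplexity_comp {m n k : ℕ} {O : Type} {S : (Fin n → Bool) → Set O}
    (hS : DecisionTree.Labels S k) {X : Set (Fin m → Bool)} (f : X → Bool) {γ : ℝ}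
    (hγ : 3 / 4 ≤ γ) :
    ((1 / 20 : ℝ≥0) : ℝ≥0∞) * (k : ℝ≥0∞) *
        (randQueryComplexity (2 / 3) (QueryProblem.ofFun f) : ℝ≥0∞) ≤
      (randQueryComplexity (γ ^ k) (QueryProblem.comp S f) : ℝ≥0∞) := by
  classical
  rcases Nat.eq_zero_or_pos k with rfl | hk
  · simp
  -- Bounding through natural numbers `ρ` also covers an infinite complexity of `f`, without first
  -- ruling it out.
  have key : ∀ ρ : ℕ, (ρ : ℕ∞) ≤ randQueryComplexity (2 / 3) (QueryProblem.ofFun f) → ∀ d : ℕ,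
      randQueryComplexity (γ ^ k) (QueryProblem.comp S f) ≤ d → k * ρ ≤ 20 * d := by
    intro ρ hρR d hd
    by_contra! hlt
    have hρ : 0 < ρ := Nat.pos_of_ne_zero fun h => by simp [h] at hlt
    have hρ' : (0 : ℝ) < ρ := by exact_mod_cast hρ
    obtain ⟨⟨R, hR⟩, hRd⟩ : ∃ R : {R : RandomizedAlgorithm (Fin n × Fin m) O //
        R.Computes (QueryProblem.comp S f) (γ ^ k)},
        R.1.worstCost (QueryProblem.comp S f) ≤ d := by
      have h : randQueryComplexity (γ ^ k) (QueryProblem.comp S f) < (d + 1 : ℕ) :=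
        hd.trans_lt (by exact_mod_cast d.lt_succ_self)
      obtain ⟨R, hR⟩ := iInf_lt_iff.1 h
      exact ⟨R, Order.lt_add_one_iff_of_not_isMax (by simp) |>.1 (by exact_mod_cast hR)⟩
    obtain ⟨μ, hμ, hμ1, hloss⟩ := exists_hard_distribution f hρ hρR
    let F : (Fin m → Bool) → Bool := fun x => if h : x ∈ X then f ⟨x, h⟩ else false
    let ν : (Fin m → Bool) → ℝ := fun x => if h : x ∈ X then μ ⟨x, h⟩ else 0
    have hsum : ∀ g : (Fin m → Bool) → ℝ, ∑ x, ν x * g x = ∑ x : X, μ x * g x := by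
      intro g
      have h : ∀ x : X, μ x * g x = ν x * g x := fun x => by simp [ν]
      rw [Fintype.sum_congr _ _ h, Finset.sum_set_coe X (f := fun x => ν x * g x)]
      refine (Finset.sum_subset (Finset.subset_univ _) fun x _ hx => ?_).symm
      simp [ν, show x ∉ X by simpa using hx]
    have h := RandomizedAlgorithm.computes_comp_le (a := 3 / ρ) (F := F) (μ := ν) hS (by positivity)
      (fun x => by simp [F]) (fun x => by simp only [ν]; split_ifs <;> simp [hμ])
      (by simpa [hμ1] using hsum fun _ => 1) (fun x hx => by simp [ν, hx])
      (le_ciInf (α := ℝ) fun D => by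
        rw [hsum fun x => D.loss (3 / ρ) x (F x)]
        simpa [F] using hloss D) hR hRd
    have h1 : (1 + 3 / (ρ : ℝ) / 2) ^ d ≤ Real.exp (3 / 40) ^ k := by
      calc (1 + 3 / (ρ : ℝ) / 2) ^ d ≤ Real.exp (3 / ρ / 2) ^ d := by
            gcongr
            linarith [Real.add_one_le_exp (3 / (ρ : ℝ) / 2)]
        _ = Real.exp (d * (3 / ρ / 2)) := by rw [Real.exp_nat_mul]
        _ ≤ Real.exp (k * (3 / 40)) := by
            apply Real.exp_le_exp.2
            have : (20 : ℝ) * d ≤ k * ρ := by exact_mod_cast hlt.le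
            rw [div_div, mul_div_assoc', div_le_iff₀ (by positivity)]
            linarith
        _ = _ := by rw [Real.exp_nat_mul]
    -- The threshold 3/4 is 2/3 · 9/8; the estimate follows from log(9/8) ≥ 1/9 > 3/40.
    have h2 : Real.exp (3 / 40) < 9 / 8 := by
      rw [← Real.lt_log_iff_exp_lt (by norm_num)]
      have := Real.one_sub_inv_le_log_of_pos (show (0 : ℝ) < 9 / 8 by norm_num)
      norm_num at this ⊢
      linarith
    have h3 : (2 / 3 * Real.exp (3 / 40)) ^ k < γ ^ k :=
      pow_lt_pow_left₀ (by linarith) (by positivity) hk.ne'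
    rw [mul_pow] at h3
    have h4 := mul_le_mul_of_nonneg_left h1 (show (0 : ℝ) ≤ (2 / 3) ^ k by positivity)
    linarith
  generalize randQueryComplexity (2 / 3) (QueryProblem.ofFun f) = Q at key ⊢
  generalize randQueryComplexity (γ ^ k) (QueryProblem.comp S f) = P at key ⊢
  induction P using ENat.recTopCoe with
  | top => simp
  | coe d =>
    induction Q using ENat.recTopCoe with
    | top =>
      -- Since `k ≥ 1`, this `ρ` is large enough to contradict `k * ρ ≤ 20 * d`.
      have := key (20 * d + 1) le_top d le_rfl
      nlinarith
    | coe ρ =>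
      have h := key ρ le_rfl d le_rfl
      have h' : (1 / 20 : ℝ≥0) * k * ρ ≤ d := by
        have : ((k * ρ : ℕ) : ℝ≥0) ≤ ((20 * d : ℕ) : ℝ≥0) := by exact_mod_cast h
        push_cast at this
        rw [mul_assoc, one_div, inv_mul_le_iff₀ (by norm_num)]
        exact this
      simpa using (by exact_mod_cast h' :
        ((1 / 20 : ℝ≥0) : ℝ≥0∞) * (k : ℝ≥0∞) * (ρ : ℝ≥0∞) ≤ (d : ℝ≥0∞))

/-! ### The threshold and choice relations -/

theorem labels_labelThreshold (n k : ℕ) : DecisionTree.Labels (labelThreshold n k) k :=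
  fun z ⟨_, hz⟩ => ⟨z, hz.1, fun _ hv => hv.2⟩

theorem labels_choiceRelation (n : ℕ) : DecisionTree.Labels (choiceRelation n) 1 := by
  rintro ⟨i, b⟩ -
  refine ⟨Function.update (fun _ => none) i (some b), ?_, fun v hv i' hi' => ?_⟩
  · rw [Finset.card_eq_one]
    refine ⟨i, Finset.ext fun i' => ?_⟩
    by_cases h : i' = i <;> simp [h]
  · have hv' : b = v i := hv
    by_cases h : i' = i
    · subst h; simp [hv']
    · simp [h] at hi'

theorem mainTheorem7 :
    ∃ c : ℝ, 1 / 2 < c ∧ c < 1 ∧ ∃ C : ℝ≥0, 0 < C ∧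
      ∀ (m : ℕ) (X : Set (Fin m → Bool)) (f : X → Bool) (n : ℕ) (γ : ℝ), c ≤ γ → γ < 1 →
        (∀ k : ℕ, k ≤ n →
          (C : ℝ≥0∞) * (k : ℝ≥0∞) *
              (randQueryComplexity (2 / 3) (QueryProblem.ofFun f) : ℝ≥0∞) ≤
            (randQueryComplexity (γ ^ k) (QueryProblem.comp (labelThreshold n k) f) : ℝ≥0∞)) ∧
        (1 ≤ n →
          (C : ℝ≥0∞) * (randQueryComplexity (2 / 3) (QueryProblem.ofFun f) : ℝ≥0∞) ≤
            (randQueryComplexity γ (QueryProblem.comp (choiceRelation n) f) : ℝ≥0∞)) := by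
  refine ⟨3 / 4, by norm_num, by norm_num, 1 / 20, by norm_num, fun m X f n γ hγ _ =>
    ⟨fun k _ => mul_le_randQueryComplexity_comp (labels_labelThreshold n k) f hγ, fun _ => ?_⟩⟩
  simpa using mul_le_randQueryComplexity_comp (labels_choiceRelation n) f hγ
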